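/- Let $d\ge 2$ and $N\ge 1$ be integers, let $m_1,\dots,m_N>0$, and let $c_1,\dots,c_N\colon\mathbb R\to\mathbb R^d$ be continuous functions with $\sup_{t\in\mathbb R}\|c_i(t)\|<+\infty$ for every $i$, where $\|\cdot\|$ is the Euclidean norm. Consider the equation $$\ddot x=-\sum_{i=1}^N\frac{m_i\,(x-c_i(t))}{\|x-c_i(t)\|^3},\qquad x\in\mathbb R^d. \qquad (*)$$ For $\xi\in\mathbb S^{d-1}=\{x\in\mathbb R^d:\|x\|=1\}$, $R>0$ and $\eta\in(0,1)$ put $$\mathcal T(\xi,R,\eta)=\Bigl\{x\in\mathbb R^d:\ \|x\|>R\ \text{ and }\ \Bigl\langle\frac{x}{\|x\|},\xi\Bigr\rangle>\eta\Bigr\}.$$ Then for every $\xi^+\in\mathbb S^{d-1}$ there exist $R'$ with $R'>\sup_{t\in\mathbb R}\|c_i(t)\|$ for every $i$, and $\eta'\in(0,1)$, such that for every $x_0\in\mathcal T(\xi^+,R',\eta')$ there is a solution $x\colon[0,+\infty)\to\mathbb R^d$ of $(*)$ (with $x(t)\ne c_i(t)$ for all $t\ge 0$ and all $i$) satisfying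 $x(0)=x_0$ that is parabolic, i.e. $$\lim_{t\to+\infty}\|x(t)\|=+\infty,\qquad \lim_{t\to+\infty}\dot x(t)=0,$$ and satisfies $$\lim_{t\to+\infty}\frac{x(t)}{\|x(t)\|}=\xi^+,\qquad \|x(t)\|\sim\Bigl(\frac92\,m\Bigr)^{1/3}t^{2/3}\quad\text{as }t\to+\infty,\qquad m=\sum_{i=1}^N m_i .$$ -/

import Mathlib

open Filter Topology Asymptotics

/-- The truncated open cone `𝒯(ξ, R, η)` of all `x ∈ ℝᵈ` with `‖x‖ > R` and `⟨x / ‖x‖, ξ⟩ > η`. -/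
def truncatedCone {d : ℕ} (ξ : EuclideanSpace ℝ (Fin d)) (R η : ℝ) :
    Set (EuclideanSpace ℝ (Fin d)) :=
  {x | R < ‖x‖ ∧ η < inner ℝ (‖x‖⁻¹ • x) ξ}

/-- The right-hand side `-∑ᵢ mᵢ (x - cᵢ(t)) / ‖x - cᵢ(t)‖³` of the equation of motion of a
massless particle attracted by `N` moving centres `cᵢ` of masses `mᵢ`. -/
noncomputable def centreForce {d N : ℕ} (m : Fin N → ℝ) (c : Fin N → ℝ → EuclideanSpace ℝ (Fin d))
    (t : ℝ) (x : EuclideanSpace ℝ (Fin d)) : EuclideanSpace ℝ (Fin d) :=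
  -∑ i, (m i / ‖x - c i t‖ ^ 3) • (x - c i t)

/-- `x` is a parabolic solution on `[0, +∞)` of `ẍ = -∑ᵢ mᵢ (x - cᵢ(t)) / ‖x - cᵢ(t)‖³`: it never
meets a centre, it is twice differentiable on `[0, +∞)` (one-sidedly at `0`; `v` is its velocity,
uniquely determined on `[0, +∞)`), it solves the equation there, and `‖x(t)‖ → +∞` and `ẋ(t) → 0`
as `t → +∞`. The values of `x` at negative times play no role. -/
def IsParabolicSolution {d N : ℕ} (m : Fin N → ℝ) (c : Fin N → ℝ → EuclideanSpace ℝ (Fin d))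
    (x : ℝ → EuclideanSpace ℝ (Fin d)) : Prop :=
  ∃ v : ℝ → EuclideanSpace ℝ (Fin d),
    (∀ t ∈ Set.Ici (0 : ℝ), (∀ i, x t ≠ c i t) ∧
      HasDerivWithinAt x (v t) (Set.Ici 0) t ∧
      HasDerivWithinAt v (centreForce m c t (x t)) (Set.Ici 0) t) ∧
    Tendsto (fun t => ‖x t‖) atTop atTop ∧
    Tendsto v atTop (𝓝 0)

/-!
Parabolic solutions are obtained as perturbations of the homothetic parabolic Kepler motion
`ρ τ^(2/3) ξ`, by a contraction argument in logarithmic time.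

Let `ρ = ‖x₀‖`, let `M` be the total mass, `T² = (2/9) ρ³ / M` and `τ = 1 + t / T`, and look for
the solution as
`x(t) = ρ (τ^(2/3) ξ + τ^(1/2) v(σ))` with `σ = log τ` (`parabolicCurve`). If `v` is bounded, the
second term is of lower order, so the direction of `x` tends to `ξ` and
`‖x‖ ~ ρ τ^(2/3) ~ (9 M / 2)^(1/3) t^(2/3)`, whatever `v` is. The equation of motion becomes
`v'' = v + F(σ, v)` with `F = rescaledForce`, and `v(0) = x₀ / ρ - ξ` is small when `x₀` lies in a
narrow cone around `ξ`.

The exponent `1/2` lies strictly between the exponents `1/3` and `2/3` of the tangential solutions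
of the linearized equation. Because of this, the linearization of `v''` in `v` is a positive
definite operator, with eigenvalues `1/36` on `ξᗮ` and `25/36` along `ξ`; hence that of `F` has
norm `35/36 < 1`, and `F` is a contraction in `v` near `0`
(`exists_ball_lipschitz_keplerField_add`). The displacement of the centres contributes an error of
size `sup ‖cᵢ‖ / ρ`, small once `ρ` is large. On the other hand `v'' = v + g`, `v(0) = v₀` has a
bounded solution on `[0, ∞)` for every bounded `g`, with
`sup ‖v‖ ≤ max (‖v₀‖, sup ‖g‖)`: factor the operator as `(D - 1)(D + 1)`, solve `z' = z + g` by
integrating from `+∞` (`expTail`) and `v' = -v + z` by integrating from `0` (`expDuhamel`). The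
Banach fixed point theorem then yields `v` (`exists_bounded_solution`).
-/

/-! ### Bounded solutions of `v'' = v + h(σ, v)` on a half-line -/

section Linear

variable {E : Type*} [NormedAddCommGroup E] [NormedSpace ℝ E]

/-- The solution `-∫_σ^∞ exp (σ - s) g(s) ds` of `z' = z + g`; for bounded `g` it is the only
bounded one. -/
noncomputable def expTail (g : ℝ → E) (σ : ℝ) : E :=
  -(Real.exp σ • ∫ s in Set.Ioi σ, Real.exp (-s) • g s)

lemma integrableOn_exp_neg_smul {g : ℝ → E} (hg : Continuous g) {B : ℝ}
    (hB : ∀ s, ‖g s‖ ≤ B) (a : ℝ) :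
    MeasureTheory.IntegrableOn (fun s => Real.exp (-s) • g s) (Set.Ioi a) := by
  refine MeasureTheory.Integrable.mono' ((integrableOn_exp_neg_Ioi a).mul_const B) ?_ ?_
  · exact (by fun_prop : Continuous fun s => Real.exp (-s) • g s).aestronglyMeasurable
  · refine Filter.Eventually.of_forall fun s => ?_
    rw [norm_smul, Real.norm_of_nonneg (Real.exp_pos _).le]
    exact mul_le_mul_of_nonneg_left (hB s) (Real.exp_pos _).le

lemma norm_expTail_le {g : ℝ → E} {B σ : ℝ} (hB : ∀ s, ‖g s‖ ≤ B) :
    ‖expTail g σ‖ ≤ B := by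
  have h : ‖∫ s in Set.Ioi σ, Real.exp (-s) • g s‖ ≤ Real.exp (-σ) * B := by
    refine (MeasureTheory.norm_integral_le_of_norm_le
      ((integrableOn_exp_neg_Ioi σ).mul_const B) (.of_forall fun s => ?_)).trans_eq ?_
    · rw [norm_smul, Real.norm_of_nonneg (Real.exp_pos _).le]
      exact mul_le_mul_of_nonneg_left (hB s) (Real.exp_pos _).le
    · rw [MeasureTheory.integral_mul_const, integral_exp_neg_Ioi]
  rw [expTail, norm_neg, norm_smul, Real.norm_of_nonneg (Real.exp_pos _).le]
  calc Real.exp σ * _ ≤ Real.exp σ * (Real.exp (-σ) * B) := by gcongr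
    _ = B := by rw [← mul_assoc, ← Real.exp_add]; simp

lemma expTail_sub {g₁ g₂ : ℝ → E} (h₁ : Continuous g₁) (h₂ : Continuous g₂) {B : ℝ}
    (hB₁ : ∀ s, ‖g₁ s‖ ≤ B) (hB₂ : ∀ s, ‖g₂ s‖ ≤ B) (σ : ℝ) :
    expTail (fun s => g₁ s - g₂ s) σ = expTail g₁ σ - expTail g₂ σ := by
  simp only [expTail, smul_sub]
  rw [MeasureTheory.integral_sub (integrableOn_exp_neg_smul h₁ hB₁ σ)
    (integrableOn_exp_neg_smul h₂ hB₂ σ), smul_sub]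
  abel

lemma hasDerivAt_expTail [CompleteSpace E] {g : ℝ → E} (hg : Continuous g) {B : ℝ}
    (hB : ∀ s, ‖g s‖ ≤ B) (σ : ℝ) :
    HasDerivAt (expTail g) (expTail g σ + g σ) σ := by
  have hc : Continuous fun s => Real.exp (-s) • g s := by fun_prop
  have key : expTail g = fun σ => -(Real.exp σ •
      ((∫ s in Set.Ioi 0, Real.exp (-s) • g s) - ∫ s in 0..σ, Real.exp (-s) • g s)) := by
    funext a
    rw [expTail, ← intervalIntegral.integral_interval_add_Ioi'
      (hc.intervalIntegrable 0 a) (integrableOn_exp_neg_smul hg hB a), add_sub_cancel_left]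
  have h1 := (hc.integral_hasStrictDerivAt 0 σ).hasDerivAt
  have h2 := ((Real.hasDerivAt_exp σ).smul
    (h1.const_sub (∫ s in Set.Ioi 0, Real.exp (-s) • g s))).neg
  have hE : Real.exp σ * Real.exp (-σ) = 1 := by rw [← Real.exp_add]; simp
  rw [key]
  refine h2.congr_deriv ?_
  rw [smul_neg, smul_smul, hE, one_smul]
  beta_reduce
  abel

/-- The solution `exp (-σ) v₀ + ∫_0^σ exp (-(σ - s)) z(s) ds` of `v' = -v + z` with initial value
`v₀`. -/
noncomputable def expDuhamel (v₀ : E) (z : ℝ → E) (σ : ℝ) : E :=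
  Real.exp (-σ) • (v₀ + ∫ s in 0..σ, Real.exp s • z s)

lemma expDuhamel_zero (v₀ : E) (z : ℝ → E) : expDuhamel v₀ z 0 = v₀ := by
  simp [expDuhamel]

lemma hasDerivAt_expDuhamel [CompleteSpace E] (v₀ : E) {z : ℝ → E} (hz : Continuous z) (σ : ℝ) :
    HasDerivAt (expDuhamel v₀ z) (z σ - expDuhamel v₀ z σ) σ := by
  have hc : Continuous fun s => Real.exp s • z s := by fun_prop
  have h1 := (hc.integral_hasStrictDerivAt 0 σ).hasDerivAt
  have h2 := ((hasDerivAt_neg σ).exp).smul (h1.const_add v₀)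
  have hE : Real.exp (-σ) * Real.exp σ = 1 := by rw [← Real.exp_add]; simp
  refine h2.congr_deriv ?_
  rw [smul_smul, hE, one_smul, expDuhamel, mul_neg_one, neg_smul]
  abel

lemma norm_expDuhamel_le {v₀ : E} {z : ℝ → E} {B σ : ℝ} (h₀ : ‖v₀‖ ≤ B) (hB : ∀ s, ‖z s‖ ≤ B)
    (hσ : 0 ≤ σ) : ‖expDuhamel v₀ z σ‖ ≤ B := by
  have h : ‖∫ s in 0..σ, Real.exp s • z s‖ ≤ (Real.exp σ - 1) * B := by
    refine (intervalIntegral.norm_integral_le_of_norm_le hσ (g := fun s => Real.exp s * B)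
      (.of_forall fun s _ => ?_) (Continuous.intervalIntegrable (by fun_prop) _ _)).trans_eq ?_
    · rw [norm_smul, Real.norm_of_nonneg (Real.exp_pos _).le]
      exact mul_le_mul_of_nonneg_left (hB s) (Real.exp_pos _).le
    · simp
  rw [expDuhamel, norm_smul, Real.norm_of_nonneg (Real.exp_pos _).le]
  calc Real.exp (-σ) * ‖v₀ + ∫ s in 0..σ, Real.exp s • z s‖
      ≤ Real.exp (-σ) * (B + (Real.exp σ - 1) * B) := by
        gcongr
        exact (norm_add_le _ _).trans (add_le_add h₀ h)
    _ = (Real.exp (-σ) * Real.exp σ) * B := by ring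
    _ = B := by rw [← Real.exp_add]; simp

lemma expDuhamel_sub (v₀ : E) {z₁ z₂ : ℝ → E} (h₁ : Continuous z₁) (h₂ : Continuous z₂) (σ : ℝ) :
    expDuhamel 0 (fun s => z₁ s - z₂ s) σ = expDuhamel v₀ z₁ σ - expDuhamel v₀ z₂ σ := by
  simp only [expDuhamel, smul_sub]
  rw [intervalIntegral.integral_sub (Continuous.intervalIntegrable (by fun_prop) _ _)
    (Continuous.intervalIntegrable (by fun_prop) _ _), ← smul_sub]
  congr 1
  abel

/-- If `h` is a contraction in `v` that maps the ball of radius `r` into itself, then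
`v'' = v + h(σ, v)` has a solution in that ball, defined on `[0, ∞)`, for every initial position in
the ball; `w` is its velocity. -/
theorem exists_bounded_solution [CompleteSpace E] {h : ℝ → E → E} {r L : ℝ} {v₀ : E}
    (hL₀ : 0 ≤ L) (hL : L < 1)
    (hcont : ContinuousOn (Function.uncurry h) (Set.Ici 0 ×ˢ Metric.closedBall 0 r))
    (hlip : ∀ σ, 0 ≤ σ → ∀ v ∈ Metric.closedBall (0 : E) r, ∀ w ∈ Metric.closedBall (0 : E) r,
      ‖h σ v - h σ w‖ ≤ L * ‖v - w‖)
    (hbound : ∀ σ, 0 ≤ σ → ∀ v ∈ Metric.closedBall (0 : E) r, ‖h σ v‖ ≤ r)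
    (hv₀ : ‖v₀‖ ≤ r) :
    ∃ v w : ℝ → E, v 0 = v₀ ∧ ∀ σ, 0 ≤ σ → ‖v σ‖ ≤ r ∧ ‖w σ‖ ≤ 2 * r ∧
      HasDerivAt v (w σ) σ ∧ HasDerivAt w (v σ + h σ (v σ)) σ := by
  -- Functions on the whole line are used so that derivatives are two-sided; only their values on
  -- `[0, ∞)` matter, and arguments are clamped to it by `max s 0`.
  let X := BoundedContinuousFunction ℝ (Metric.closedBall (0 : E) r)
  let g : X → ℝ → E := fun u s => h (max s 0) (u s)
  have hg : ∀ u, Continuous (g u) := fun u =>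
    hcont.comp_continuous (f := fun s => (max s 0, (u s : E)))
      ((continuous_id.max continuous_const).prodMk (continuous_subtype_val.comp u.continuous))
      fun s => ⟨Set.mem_Ici.2 (le_max_right s 0), (u s).2⟩
  have hgB : ∀ u s, ‖g u s‖ ≤ r := fun u s => hbound _ (le_max_right _ _) _ (u s).2
  have hz : ∀ u, Continuous (expTail (g u)) := fun u =>
    continuous_iff_continuousAt.2 fun σ => (hasDerivAt_expTail (hg u) (hgB u) σ).continuousAt
  have hv : ∀ u, Continuous (expDuhamel v₀ (expTail (g u))) := fun u =>
    continuous_iff_continuousAt.2 fun σ => (hasDerivAt_expDuhamel v₀ (hz u) σ).continuousAt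
  have hvB : ∀ u σ, 0 ≤ σ → ‖expDuhamel v₀ (expTail (g u)) σ‖ ≤ r := fun u σ hσ =>
    norm_expDuhamel_le hv₀ (fun s => norm_expTail_le (hgB u)) hσ
  let S : X → X := fun u => BoundedContinuousFunction.mkOfBound
    ⟨fun s => ⟨expDuhamel v₀ (expTail (g u)) (max s 0),
      mem_closedBall_zero_iff.2 (hvB u _ (le_max_right _ _))⟩,
      ((hv u).comp (continuous_id.max continuous_const)).subtype_mk _⟩ (r + r) (by
      intro s t
      rw [Subtype.dist_eq, dist_eq_norm]
      exact (norm_sub_le _ _).trans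
        (add_le_add (hvB u _ (le_max_right _ _)) (hvB u _ (le_max_right _ _))))
  have hS : ContractingWith ⟨L, hL₀⟩ S := by
    refine ⟨by exact_mod_cast hL, LipschitzWith.of_dist_le_mul fun u₁ u₂ => ?_⟩
    refine (BoundedContinuousFunction.dist_le (by positivity)).2 fun s => ?_
    have hgd : ∀ t, ‖g u₁ t - g u₂ t‖ ≤ L * dist u₁ u₂ := fun t => by
      refine (hlip _ (le_max_right _ _) _ (u₁ t).2 _ (u₂ t).2).trans ?_
      gcongr
      rw [← dist_eq_norm]
      exact BoundedContinuousFunction.dist_coe_le_dist (f := u₁) (g := u₂) t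
    change dist (expDuhamel v₀ (expTail (g u₁)) (max s 0))
      (expDuhamel v₀ (expTail (g u₂)) (max s 0)) ≤ L * dist u₁ u₂
    rw [dist_eq_norm, ← expDuhamel_sub v₀ (hz u₁) (hz u₂)]
    refine norm_expDuhamel_le (by simp; positivity) (fun t => ?_) (le_max_right _ _)
    rw [← expTail_sub (hg u₁) (hg u₂) (hgB u₁) (hgB u₂)]
    exact norm_expTail_le hgd
  have : CompleteSpace (Metric.closedBall (0 : E) r) :=
    Metric.isClosed_closedBall.completeSpace_coe
  have : Nonempty X := ⟨BoundedContinuousFunction.const ℝ ⟨v₀, mem_closedBall_zero_iff.2 hv₀⟩⟩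
  let u := ContractingWith.fixedPoint S hS
  have hu : S u = u := hS.fixedPoint_isFixedPt
  have huv : ∀ σ, 0 ≤ σ → (u σ : E) = expDuhamel v₀ (expTail (g u)) σ := fun σ hσ => by
    conv_lhs => rw [← hu]
    change expDuhamel v₀ (expTail (g u)) (max σ 0) = _
    rw [max_eq_left hσ]
  refine ⟨expDuhamel v₀ (expTail (g u)),
    fun σ => expTail (g u) σ - expDuhamel v₀ (expTail (g u)) σ, expDuhamel_zero _ _,
    fun σ hσ => ⟨hvB u σ hσ, ?_, hasDerivAt_expDuhamel v₀ (hz u) σ, ?_⟩⟩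
  · have := (norm_sub_le (expTail (g u) σ) (expDuhamel v₀ (expTail (g u)) σ)).trans
      (add_le_add (norm_expTail_le (hgB u)) (hvB u σ hσ))
    linarith
  · refine ((hasDerivAt_expTail (hg u) (hgB u) σ).sub
      (hasDerivAt_expDuhamel v₀ (hz u) σ)).congr_deriv ?_
    have : g u σ = h σ (expDuhamel v₀ (expTail (g u)) σ) := by
      simp only [g, max_eq_left hσ, huv σ hσ]
    rw [this]
    abel

end Linear

/-! ### The Kepler field near a unit vector and the rescaled force -/

section Kepler

variable {E : Type*} [NormedAddCommGroup E] [InnerProductSpace ℝ E]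

/-- The inverse-square field `z / ‖z‖³` (equal to `0` at `z = 0`). -/
noncomputable def keplerField (z : E) : E := (‖z‖ ^ 3)⁻¹ • z

lemma keplerField_of_norm_eq_one {ξ : E} (hξ : ‖ξ‖ = 1) : keplerField ξ = ξ := by
  simp [keplerField, hξ]

lemma keplerField_smul {a : ℝ} (ha : 0 < a) (z : E) :
    keplerField (a • z) = (a ^ 2)⁻¹ • keplerField z := by
  rw [keplerField, keplerField, norm_smul, Real.norm_of_nonneg ha.le, smul_smul, smul_smul]
  congr 1
  rcases eq_or_ne ‖z‖ 0 with h | h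
  · simp [h]
  · field_simp

lemma continuousOn_keplerField : ContinuousOn (keplerField : E → E) {0}ᶜ := by
  unfold keplerField
  refine ContinuousOn.smul (ContinuousOn.inv₀ (by fun_prop) fun z hz => ?_) continuousOn_id
  exact pow_ne_zero _ (norm_ne_zero_iff.2 hz)

lemma hasStrictFDerivAt_keplerField {ξ : E} (hξ : ‖ξ‖ = 1) :
    HasStrictFDerivAt (keplerField : E → E)
      (ContinuousLinearMap.id ℝ E - (3 : ℝ) • (innerSL ℝ ξ).smulRight ξ) ξ := by
  have h1 : HasStrictFDerivAt (fun z : E => (‖z‖ ^ 2) ^ (-(3 / 2) : ℝ)) _ ξ :=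
    (hasStrictFDerivAt_norm_sq ξ).rpow_const (p := -(3 / 2)) (Or.inl (by simp [hξ]))
  have h2 := h1.smul (hasStrictFDerivAt_id ξ)
  have heq : (keplerField : E → E) = fun z => (‖z‖ ^ 2) ^ (-(3 / 2) : ℝ) • id z := by
    funext z
    rw [keplerField, ← Real.rpow_natCast ‖z‖ 2, ← Real.rpow_mul (norm_nonneg z),
      ← Real.rpow_natCast ‖z‖ 3, ← Real.rpow_neg (norm_nonneg z), id]
    norm_num
  rw [heq]
  refine h2.congr_fderiv ?_
  ext w
  simp [hξ, smul_smul]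
  module

/-- The derivative `3/4 + (2/9) (1 - 3 ξ ξᵀ)` of `(3/4) z + (2/9) z / ‖z‖³` at the unit vector `ξ`
has the eigenvalues `35/36` and `11/36`, so that this map is a contraction near `ξ`. -/
lemma exists_ball_lipschitz_keplerField_add {ξ : E} (hξ : ‖ξ‖ = 1) :
    ∃ δ, 0 < δ ∧ δ ≤ 1 ∧ ∀ z ∈ Metric.ball ξ δ, ∀ w ∈ Metric.ball ξ δ,
      ‖((3 / 4 : ℝ) • z + (2 / 9 : ℝ) • keplerField z)
        - ((3 / 4 : ℝ) • w + (2 / 9 : ℝ) • keplerField w)‖ ≤ 71 / 72 * ‖z - w‖ := by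
  have hd := ((hasStrictFDerivAt_id ξ).const_smul (3 / 4 : ℝ)).add
    ((hasStrictFDerivAt_keplerField hξ).const_smul (2 / 9 : ℝ))
  set A := (3 / 4 : ℝ) • ContinuousLinearMap.id ℝ E +
    (2 / 9 : ℝ) • (ContinuousLinearMap.id ℝ E - (3 : ℝ) • (innerSL ℝ ξ).smulRight ξ) with hA
  have hnorm : ‖A‖ ≤ 35 / 36 := by
    refine A.opNorm_le_bound (by norm_num) fun w => ?_
    have hAw : A w = (35 / 36 : ℝ) • w - (2 / 3 * inner ℝ ξ w : ℝ) • ξ := by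
      simp [hA]
      module
    refine le_of_sq_le_sq ?_ (by positivity)
    rw [hAw, norm_sub_sq_real, norm_smul, norm_smul, inner_smul_left, inner_smul_right,
      real_inner_comm, hξ, Real.norm_eq_abs, Real.norm_eq_abs, mul_pow, mul_pow, sq_abs, sq_abs]
    simp only [conj_trivial]
    nlinarith [sq_nonneg (inner ℝ ξ w)]
  obtain ⟨s, hs, hlip⟩ := hd.exists_lipschitzOnWith_of_nnnorm_lt (71 / 72) (by
    rw [← NNReal.coe_lt_coe]
    push_cast
    exact hnorm.trans_lt (by norm_num))
  obtain ⟨δ, hδ, hδs⟩ := Metric.mem_nhds_iff.1 hs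
  refine ⟨min δ 1, lt_min hδ one_pos, min_le_right _ _, fun z hz w hw => ?_⟩
  have hsub := (Metric.ball_subset_ball (min_le_left δ 1)).trans hδs
  have := hlip.dist_le_mul z (hsub hz) w (hsub hw)
  rw [dist_eq_norm, dist_eq_norm] at this
  simpa using this

/-- The position relative to a centre, divided by the size `τ^(2/3)` of the unperturbed motion, at
`τ = exp σ`: it is `ξ + τ^(-1/6) v - τ^(-2/3) c(σ)`. -/
noncomputable def rescaledPosition (ξ : E) (c : ℝ → E) (σ : ℝ) (v : E) : E :=
  ξ + Real.exp (-σ / 6) • v - Real.exp (-(2 * σ) / 3) • c σ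

/-- The nonlinearity `F` for which the equation of motion reads `v'' = v + F(σ, v)`, for centres of
relative masses `μ i` at the rescaled positions `c i`. -/
noncomputable def rescaledForce {ι : Type*} [Fintype ι] (ξ : E) (μ : ι → ℝ) (c : ι → ℝ → E)
    (σ : ℝ) (v : E) : E :=
  -((3 / 4 : ℝ) • v) - (2 / 9 * Real.exp (σ / 6)) •
    (∑ i, μ i • keplerField (rescaledPosition ξ (c i) σ v) - ξ)

variable {ι : Type*} [Fintype ι] {ξ : E} {μ : ι → ℝ} {c : ι → ℝ → E}

/-- The force in terms of increments of the contraction `(3/4) z + (2/9) z / ‖z‖³`. -/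
lemma rescaledForce_eq (hξ : ‖ξ‖ = 1) (hμ : ∑ i, μ i = 1) (σ : ℝ) (v : E) :
    rescaledForce ξ μ c σ v = -(Real.exp (σ / 6) • ∑ i, μ i •
      (((3 / 4 : ℝ) • rescaledPosition ξ (c i) σ v
          + (2 / 9 : ℝ) • keplerField (rescaledPosition ξ (c i) σ v))
        - ((3 / 4 : ℝ) • ξ + (2 / 9 : ℝ) • keplerField ξ)
        + (3 / 4 * Real.exp (-(2 * σ) / 3)) • c i σ)) := by
  have hterm : ∀ i, μ i • (((3 / 4 : ℝ) • rescaledPosition ξ (c i) σ v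
          + (2 / 9 : ℝ) • keplerField (rescaledPosition ξ (c i) σ v))
        - ((3 / 4 : ℝ) • ξ + (2 / 9 : ℝ) • keplerField ξ)
        + (3 / 4 * Real.exp (-(2 * σ) / 3)) • c i σ) =
      μ i • ((3 / 4 * Real.exp (-σ / 6)) • v - (2 / 9 : ℝ) • ξ)
        + (2 / 9 : ℝ) • (μ i • keplerField (rescaledPosition ξ (c i) σ v)) := fun i => by
    rw [keplerField_of_norm_eq_one hξ]
    nth_rw 1 [rescaledPosition]
    module
  have hE : Real.exp (σ / 6) * Real.exp (-σ / 6) = 1 := by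
    rw [← Real.exp_add, ← Real.exp_zero]; ring_nf
  have hv : Real.exp (σ / 6) • ((3 / 4 * Real.exp (-σ / 6)) • v) = (3 / 4 : ℝ) • v := by
    rw [smul_smul, mul_left_comm, hE, mul_one]
  simp only [hterm]
  rw [Finset.sum_add_distrib, ← Finset.sum_smul, hμ, ← Finset.smul_sum, one_smul, smul_add,
    smul_sub, hv, rescaledForce]
  module

lemma norm_rescaledPosition_sub_le {c : ℝ → E} {r ε σ : ℝ} {v : E} (hv : ‖v‖ ≤ r)
    (hc : ‖c σ‖ ≤ ε) : ‖rescaledPosition ξ c σ v - ξ‖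
      ≤ Real.exp (-σ / 6) * r + Real.exp (-(2 * σ) / 3) * ε := by
  have : rescaledPosition ξ c σ v - ξ =
      Real.exp (-σ / 6) • v - Real.exp (-(2 * σ) / 3) • c σ := by
    rw [rescaledPosition]; abel
  rw [this]
  refine (norm_sub_le _ _).trans ?_
  rw [norm_smul, norm_smul, Real.norm_of_nonneg (Real.exp_pos _).le,
    Real.norm_of_nonneg (Real.exp_pos _).le]
  gcongr

/-- The radius `r` and the bound `ε` on the rescaled centres depend on `ξ` only, and not on the
masses or the centres: this gives the uniformity in the initial position. -/
theorem exists_rescaled_solution [CompleteSpace E] (hξ : ‖ξ‖ = 1) :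
    ∃ r ε : ℝ, 0 < r ∧ r ≤ 1 / 2 ∧ 0 < ε ∧ ∀ (μ : ι → ℝ) (c : ι → ℝ → E),
      (∀ i, 0 ≤ μ i) → ∑ i, μ i = 1 → (∀ i, Continuous (c i)) → (∀ i σ, ‖c i σ‖ ≤ ε) →
      ∀ v₀ : E, ‖v₀‖ ≤ r → ∃ v w : ℝ → E, v 0 = v₀ ∧ ∀ σ, 0 ≤ σ →
        ‖v σ‖ ≤ r ∧ ‖w σ‖ ≤ 2 * r ∧ HasDerivAt v (w σ) σ ∧
        HasDerivAt w (v σ + rescaledForce ξ μ c σ (v σ)) σ ∧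
        ∀ i, rescaledPosition ξ (c i) σ (v σ) ≠ 0 := by
  obtain ⟨δ, hδ, hδ1, hlip⟩ := exists_ball_lipschitz_keplerField_add hξ
  -- `δ / 288` is chosen such that `(71 / 72) (δ / 2) + 2 (δ / 288) = δ / 2`.
  refine ⟨δ / 2, δ / 288, by positivity, by linarith, by positivity,
    fun μ c hμ₀ hμ hc hcε v₀ hv₀ => ?_⟩
  have hball : ∀ i σ, 0 ≤ σ → ∀ v ∈ Metric.closedBall (0 : E) (δ / 2),
      rescaledPosition ξ (c i) σ v ∈ Metric.ball ξ δ := fun i σ hσ v hv => by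
    rw [Metric.mem_ball, dist_eq_norm]
    have h1 : Real.exp (-σ / 6) ≤ 1 := Real.exp_le_one_iff.2 (by linarith)
    have h2 : Real.exp (-(2 * σ) / 3) ≤ 1 := Real.exp_le_one_iff.2 (by linarith)
    refine (norm_rescaledPosition_sub_le (mem_closedBall_zero_iff.1 hv) (hcε i σ)).trans_lt ?_
    nlinarith
  have hne : ∀ i σ, 0 ≤ σ → ∀ v ∈ Metric.closedBall (0 : E) (δ / 2),
      rescaledPosition ξ (c i) σ v ≠ 0 := fun i σ hσ v hv h0 => by
    have := hball i σ hσ v hv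
    rw [h0, Metric.mem_ball, dist_zero_left, hξ] at this
    linarith
  have hE : ∀ σ : ℝ, Real.exp (σ / 6) * Real.exp (-σ / 6) = 1 := fun σ => by
    rw [← Real.exp_add, ← Real.exp_zero]; ring_nf
  have hcont : ContinuousOn (Function.uncurry (rescaledForce ξ μ c))
      (Set.Ici 0 ×ˢ Metric.closedBall 0 (δ / 2)) := by
    have hpos : ∀ i, ContinuousOn (fun p : ℝ × E =>
        keplerField (rescaledPosition ξ (c i) p.1 p.2))
        (Set.Ici 0 ×ˢ Metric.closedBall 0 (δ / 2)) := fun i => by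
      refine continuousOn_keplerField.comp (t := {0}ᶜ) ?_ fun p hp => hne i p.1 hp.1 p.2 hp.2
      have := hc i
      unfold rescaledPosition
      fun_prop
    change ContinuousOn (fun p : ℝ × E => rescaledForce ξ μ c p.1 p.2) _
    unfold rescaledForce
    refine ContinuousOn.sub (by fun_prop) (ContinuousOn.smul (by fun_prop)
      (ContinuousOn.sub (continuousOn_finsetSum _ fun i _ => ?_) continuousOn_const))
    exact (hpos i).const_smul (μ i)
  have hlipF : ∀ σ, 0 ≤ σ → ∀ v ∈ Metric.closedBall (0 : E) (δ / 2),
      ∀ w ∈ Metric.closedBall (0 : E) (δ / 2),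
      ‖rescaledForce ξ μ c σ v - rescaledForce ξ μ c σ w‖ ≤ 71 / 72 * ‖v - w‖ := by
    intro σ hσ v hv w hw
    have hdiff : ∀ i, rescaledPosition ξ (c i) σ v - rescaledPosition ξ (c i) σ w
        = Real.exp (-σ / 6) • (v - w) := fun i => by
      simp only [rescaledPosition]
      module
    rw [rescaledForce_eq hξ hμ, rescaledForce_eq hξ hμ, neg_sub_neg, ← smul_sub,
      ← Finset.sum_sub_distrib, norm_smul, Real.norm_of_nonneg (Real.exp_pos _).le]
    calc _ ≤ Real.exp (σ / 6) * ∑ i, μ i * (71 / 72 * (Real.exp (-σ / 6) * ‖v - w‖)) := by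
          gcongr
          refine norm_sum_le_of_le _ fun i _ => ?_
          rw [← smul_sub, norm_smul, Real.norm_of_nonneg (hμ₀ i)]
          gcongr
          · exact hμ₀ i
          rw [add_sub_add_right_eq_sub, sub_sub_sub_cancel_right]
          refine (hlip _ (hball i σ hσ w hw) _ (hball i σ hσ v hv)).trans_eq ?_
          rw [norm_sub_rev, hdiff, norm_smul, Real.norm_of_nonneg (Real.exp_pos _).le]
      _ = (Real.exp (σ / 6) * Real.exp (-σ / 6)) * (71 / 72 * ‖v - w‖) := by
          rw [← Finset.sum_mul, hμ]; ring
      _ = 71 / 72 * ‖v - w‖ := by rw [hE, one_mul]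
  have hboundF : ∀ σ, 0 ≤ σ → ∀ v ∈ Metric.closedBall (0 : E) (δ / 2),
      ‖rescaledForce ξ μ c σ v‖ ≤ δ / 2 := by
    intro σ hσ v hv
    rw [rescaledForce_eq hξ hμ, norm_neg, norm_smul, Real.norm_of_nonneg (Real.exp_pos _).le]
    have hexp : Real.exp (-(2 * σ) / 3) ≤ Real.exp (-σ / 6) := by
      apply Real.exp_le_exp.2; linarith
    have hv' := mem_closedBall_zero_iff.1 hv
    calc _ ≤ Real.exp (σ / 6) * ∑ i, μ i * (Real.exp (-σ / 6) * (δ / 2)) := by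
          gcongr
          refine norm_sum_le_of_le _ fun i _ => ?_
          rw [norm_smul, Real.norm_of_nonneg (hμ₀ i)]
          gcongr
          · exact hμ₀ i
          have h1 := hlip _ (hball i σ hσ v hv) ξ (Metric.mem_ball_self hδ)
          have h2 := norm_rescaledPosition_sub_le (ξ := ξ) hv' (hcε i σ)
          have h3 : ‖(3 / 4 * Real.exp (-(2 * σ) / 3)) • c i σ‖
              ≤ Real.exp (-(2 * σ) / 3) * (δ / 288) := by
            rw [norm_smul, Real.norm_of_nonneg (by positivity)]
            have := mul_le_mul_of_nonneg_left (hcε i σ) (Real.exp_pos (-(2 * σ) / 3)).le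
            nlinarith [mul_nonneg (Real.exp_pos (-(2 * σ) / 3)).le (norm_nonneg (c i σ))]
          refine (norm_add_le _ _).trans ?_
          nlinarith [mul_le_mul_of_nonneg_right hexp hδ.le,
            mul_nonneg (Real.exp_pos (-(2 * σ) / 3)).le hδ.le]
      _ = (Real.exp (σ / 6) * Real.exp (-σ / 6)) * (δ / 2) := by
          rw [← Finset.sum_mul, hμ]; ring
      _ = δ / 2 := by rw [hE, one_mul]
  obtain ⟨v, w, hv0, hvw⟩ := exists_bounded_solution (by norm_num) (by norm_num)
    hcont hlipF hboundF hv₀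
  refine ⟨v, w, hv0, fun σ hσ => ?_⟩
  obtain ⟨h1, h2, h3, h4⟩ := hvw σ hσ
  exact ⟨h1, h2, h3, h4, fun i => hne i σ hσ _ (mem_closedBall_zero_iff.2 h1)⟩

end Kepler

/-! ### Curves asymptotic to a parabolic homothetic motion -/

section Scaling

variable {E : Type*} [NormedAddCommGroup E] [NormedSpace ℝ E]

/-- The perturbation `τ^(2/3) ξ + τ^(1/2) v(log τ)` of the homothetic parabolic motion. -/
noncomputable def parabolicCurve (ξ : E) (v : ℝ → E) (τ : ℝ) : E :=
  τ ^ (2 / 3 : ℝ) • ξ + τ ^ (1 / 2 : ℝ) • v (Real.log τ)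

/-- The derivative of `parabolicCurve ξ v` when `w` is the derivative of `v`. -/
noncomputable def parabolicVelocity (ξ : E) (v w : ℝ → E) (τ : ℝ) : E :=
  (2 / 3 * τ ^ (-1 / 3 : ℝ)) • ξ
    + τ ^ (-1 / 2 : ℝ) • ((1 / 2 : ℝ) • v (Real.log τ) + w (Real.log τ))

lemma hasDerivAt_parabolicCurve (ξ : E) {v w : ℝ → E} {τ : ℝ} (hτ : 0 < τ)
    (hv : HasDerivAt v (w (Real.log τ)) (Real.log τ)) :
    HasDerivAt (parabolicCurve ξ v) (parabolicVelocity ξ v w τ) τ := by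
  have h1 := (Real.hasDerivAt_rpow_const (x := τ) (p := 2 / 3) (Or.inl hτ.ne')).smul_const ξ
  have h2 := (Real.hasDerivAt_rpow_const (x := τ) (p := 1 / 2) (Or.inl hτ.ne')).smul
    (hv.scomp τ (Real.hasDerivAt_log hτ.ne'))
  refine (h1.add h2).congr_deriv ?_
  have e : τ ^ (-1 / 2 : ℝ) = τ ^ (1 / 2 : ℝ) * τ⁻¹ := by
    rw [← Real.rpow_neg_one τ, ← Real.rpow_add hτ]; norm_num
  have e1 : (2 / 3 - 1 : ℝ) = -1 / 3 := by norm_num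
  have e2 : (1 / 2 - 1 : ℝ) = -1 / 2 := by norm_num
  rw [e1, e2, smul_smul, ← e, parabolicVelocity]
  simp only [Function.comp]
  module

lemma hasDerivAt_parabolicVelocity (ξ : E) {v w : ℝ → E} {w' : E} {τ : ℝ} (hτ : 0 < τ)
    (hv : HasDerivAt v (w (Real.log τ)) (Real.log τ)) (hw : HasDerivAt w w' (Real.log τ)) :
    HasDerivAt (parabolicVelocity ξ v w)
      (-((2 / 9 * τ ^ (-4 / 3 : ℝ)) • ξ)
        + τ ^ (-3 / 2 : ℝ) • (w' - (1 / 4 : ℝ) • v (Real.log τ))) τ := by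
  have hlog := Real.hasDerivAt_log hτ.ne'
  have h1 := ((Real.hasDerivAt_rpow_const (x := τ) (p := -1 / 3)
    (Or.inl hτ.ne')).const_mul (2 / 3)).smul_const ξ
  have h2 := (Real.hasDerivAt_rpow_const (x := τ) (p := -1 / 2) (Or.inl hτ.ne')).smul
    (((hv.scomp τ hlog).const_smul (1 / 2 : ℝ)).add (hw.scomp τ hlog))
  refine (h1.add h2).congr_deriv ?_
  have e : τ ^ (-3 / 2 : ℝ) = τ ^ (-1 / 2 : ℝ) * τ⁻¹ := by
    rw [← Real.rpow_neg_one τ, ← Real.rpow_add hτ]; norm_num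
  have e1 : (-1 / 3 - 1 : ℝ) = -4 / 3 := by norm_num
  have e2 : (-1 / 2 - 1 : ℝ) = -3 / 2 := by norm_num
  rw [e1, e2, smul_add, smul_comm (τ ^ (-1 / 2 : ℝ)) (1 / 2 : ℝ), smul_smul (τ ^ (-1 / 2 : ℝ)),
    smul_smul (τ ^ (-1 / 2 : ℝ)), ← e]
  simp only [Function.comp, Pi.add_apply, Pi.smul_apply]
  module

lemma parabolicCurve_eq_smul (ξ : E) (v : ℝ → E) {τ : ℝ} (hτ : 0 < τ) :
    parabolicCurve ξ v τ = τ ^ (2 / 3 : ℝ) • (ξ + τ ^ (-1 / 6 : ℝ) • v (Real.log τ)) := by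
  rw [parabolicCurve, smul_add, smul_smul, ← Real.rpow_add hτ]
  norm_num

lemma tendsto_rpow_smul_of_bounded {f : ℝ → E} {p B : ℝ} (hp : p < 0)
    (hf : ∀ τ, 1 ≤ τ → ‖f τ‖ ≤ B) : Tendsto (fun τ : ℝ => τ ^ p • f τ) atTop (𝓝 0) := by
  have h0 : Tendsto (fun τ : ℝ => τ ^ p) atTop (𝓝 0) := by
    simpa using tendsto_rpow_neg_atTop (y := -p) (by linarith)
  refine h0.zero_smul_isBoundedUnder_le ?_
  refine isBoundedUnder_of_eventually_le (a := B) ?_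
  filter_upwards [eventually_ge_atTop 1] with τ hτ using hf τ hτ

lemma tendsto_rpow_smul_parabolicCurve (ξ : E) {v : ℝ → E} {B : ℝ}
    (hv : ∀ σ, 0 ≤ σ → ‖v σ‖ ≤ B) :
    Tendsto (fun τ : ℝ => (τ ^ (2 / 3 : ℝ))⁻¹ • parabolicCurve ξ v τ) atTop (𝓝 ξ) := by
  have h : Tendsto (fun τ : ℝ => ξ + τ ^ (-1 / 6 : ℝ) • v (Real.log τ)) atTop (𝓝 ξ) := by
    simpa using tendsto_const_nhds (x := ξ) |>.add (tendsto_rpow_smul_of_bounded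
      (f := fun τ => v (Real.log τ)) (p := -1 / 6) (by norm_num)
      fun τ hτ => hv _ (Real.log_nonneg hτ))
  refine h.congr' ?_
  filter_upwards [eventually_gt_atTop 0] with τ hτ
  rw [parabolicCurve_eq_smul ξ v hτ, smul_smul, inv_mul_cancel₀ (by positivity), one_smul]

lemma isEquivalent_norm_parabolicCurve {ξ : E} (hξ : ‖ξ‖ = 1) {v : ℝ → E} {B : ℝ}
    (hv : ∀ σ, 0 ≤ σ → ‖v σ‖ ≤ B) :
    (fun τ => ‖parabolicCurve ξ v τ‖) ~[atTop] fun τ : ℝ => τ ^ (2 / 3 : ℝ) := by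
  have h := (tendsto_rpow_smul_parabolicCurve ξ hv).norm
  rw [hξ] at h
  refine (isEquivalent_iff_tendsto_one ?_).2 (h.congr' ?_)
  · filter_upwards [eventually_gt_atTop 0] with τ hτ
    positivity
  · filter_upwards [eventually_gt_atTop 0] with τ hτ
    rw [norm_smul, norm_inv, Real.norm_of_nonneg (by positivity), Pi.div_apply, div_eq_inv_mul ‖_‖]

lemma tendsto_parabolicCurve_direction {ξ : E} (hξ : ‖ξ‖ = 1) {v : ℝ → E} {B : ℝ}
    (hv : ∀ σ, 0 ≤ σ → ‖v σ‖ ≤ B) :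
    Tendsto (fun τ => ‖parabolicCurve ξ v τ‖⁻¹ • parabolicCurve ξ v τ) atTop (𝓝 ξ) := by
  have h := tendsto_rpow_smul_parabolicCurve ξ hv
  have h' := (h.norm.inv₀ (by simp [hξ])).smul h
  rw [hξ, inv_one, one_smul] at h'
  refine h'.congr' ?_
  filter_upwards [eventually_gt_atTop 0] with τ hτ
  have hp : 0 < τ ^ (2 / 3 : ℝ) := by positivity
  rw [norm_smul, norm_inv, Real.norm_of_nonneg hp.le, smul_smul, mul_inv, inv_inv,
    mul_right_comm, mul_inv_cancel₀ hp.ne', one_mul]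

lemma isEquivalent_one_add_div_rpow {T : ℝ} (hT : 0 < T) (p : ℝ) :
    (fun t => (1 + t / T) ^ p) ~[atTop] fun t => T⁻¹ ^ p * t ^ p := by
  have h : (fun t => 1 + t / T) ~[atTop] fun t => |t / T| := by
    refine (isEquivalent_iff_tendsto_one ?_).2 ?_
    · filter_upwards [eventually_gt_atTop 0] with t ht
      positivity
    · have : Tendsto (fun t : ℝ => 1 + T * t⁻¹) atTop (𝓝 1) := by
        simpa using (tendsto_inv_atTop_zero.const_mul T).const_add (1 : ℝ)
      refine this.congr' ?_
      filter_upwards [eventually_gt_atTop 0] with t ht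
      rw [Pi.div_apply, abs_of_pos (by positivity)]
      field_simp
      ring
  -- `|t / T|` rather than `t / T` because `IsEquivalent.rpow` asks for a nonnegative function.
  refine (h.rpow (r := p) fun t => abs_nonneg _).congr_right ?_
  filter_upwards [eventually_ge_atTop 0] with t ht
  rw [Pi.pow_apply, abs_of_nonneg (by positivity), div_eq_inv_mul,
    Real.mul_rpow (by positivity) ht]

lemma tendsto_parabolicVelocity (ξ : E) {v w : ℝ → E} {B C : ℝ}
    (hv : ∀ σ, 0 ≤ σ → ‖v σ‖ ≤ B) (hw : ∀ σ, 0 ≤ σ → ‖w σ‖ ≤ C) :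
    Tendsto (parabolicVelocity ξ v w) atTop (𝓝 0) := by
  have h1 := tendsto_rpow_smul_of_bounded (f := fun _ => (2 / 3 : ℝ) • ξ) (p := -1 / 3)
    (by norm_num) fun τ _ => le_rfl
  have h2 := tendsto_rpow_smul_of_bounded
    (f := fun τ => (1 / 2 : ℝ) • v (Real.log τ) + w (Real.log τ)) (p := -1 / 2)
    (B := 1 / 2 * B + C) (by norm_num) fun τ hτ => by
      refine (norm_add_le _ _).trans (add_le_add ?_ (hw _ (Real.log_nonneg hτ)))
      rw [norm_smul, Real.norm_of_nonneg (by norm_num)]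
      exact mul_le_mul_of_nonneg_left (hv _ (Real.log_nonneg hτ)) (by norm_num)
  refine (by simpa using h1.add h2 :
    Tendsto (fun τ : ℝ => τ ^ (-1 / 3 : ℝ) • (2 / 3 : ℝ) • ξ
      + τ ^ (-1 / 2 : ℝ) • ((1 / 2 : ℝ) • v (Real.log τ) + w (Real.log τ))) atTop (𝓝 0)).congr
    fun τ => ?_
  rw [parabolicVelocity, smul_smul, mul_comm (2 / 3 : ℝ)]

end Scaling

/-! ### Parabolic solutions with prescribed initial position and direction -/

lemma norm_sub_le_of_lt_inner {E : Type*} [NormedAddCommGroup E] [InnerProductSpace ℝ E]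
    {u ξ : E} {r : ℝ} (hr : 0 ≤ r) (hu : ‖u‖ = 1) (hξ : ‖ξ‖ = 1)
    (h : 1 - r ^ 2 / 2 < inner ℝ u ξ) : ‖u - ξ‖ ≤ r := by
  refine le_of_sq_le_sq ?_ hr
  rw [norm_sub_sq_real, hu, hξ]
  linarith

theorem corollary6p1 {d N : ℕ} (hd : 2 ≤ d) (hN : 1 ≤ N)
    (m : Fin N → ℝ) (hm : ∀ i, 0 < m i)
    (c : Fin N → ℝ → EuclideanSpace ℝ (Fin d)) (hc : ∀ i, Continuous (c i))
    (hbdd : ∀ i, BddAbove (Set.range fun t : ℝ => ‖c i t‖))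
    (ξ : EuclideanSpace ℝ (Fin d)) (hξ : ξ ∈ Metric.sphere (0 : EuclideanSpace ℝ (Fin d)) 1) :
    ∃ R' η' : ℝ, (∀ i, (⨆ t : ℝ, ‖c i t‖) < R') ∧ η' ∈ Set.Ioo (0 : ℝ) 1 ∧
      ∀ x₀ ∈ truncatedCone ξ R' η',
        ∃ x : ℝ → EuclideanSpace ℝ (Fin d),
          IsParabolicSolution m c x ∧ x 0 = x₀ ∧
          Tendsto (fun t => ‖x t‖⁻¹ • x t) atTop (𝓝 ξ) ∧
          (fun t => ‖x t‖) ~[atTop]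
            (fun t : ℝ => (9 / 2 * ∑ i, m i) ^ (1 / 3 : ℝ) * t ^ (2 / 3 : ℝ)) := by
  have hξ1 : ‖ξ‖ = 1 := mem_sphere_zero_iff_norm.1 hξ
  have hM : 0 < ∑ i, m i := Finset.sum_pos (fun i _ => hm i) ⟨⟨0, hN⟩, Finset.mem_univ _⟩
  set M := ∑ i, m i
  obtain ⟨r, ε, hr, hr2, hε, hsol⟩ :=
    exists_rescaled_solution (ι := Fin N) (ξ := ξ) hξ1
  have hsup₀ : ∀ i, 0 ≤ ⨆ t : ℝ, ‖c i t‖ := fun i => Real.iSup_nonneg fun t => norm_nonneg _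
  set Q := ∑ i, ⨆ t : ℝ, ‖c i t‖
  have hQ₀ : 0 ≤ Q := Finset.sum_nonneg fun i _ => hsup₀ i
  have hsupQ : ∀ i, (⨆ t : ℝ, ‖c i t‖) ≤ Q := fun i =>
    Finset.single_le_sum (f := fun i => ⨆ t : ℝ, ‖c i t‖) (fun i _ => hsup₀ i) (Finset.mem_univ i)
  have hcQ : ∀ i t, ‖c i t‖ ≤ Q := fun i t => (le_ciSup (hbdd i) t).trans (hsupQ i)
  refine ⟨Q + 1 + Q / ε, 1 - r ^ 2 / 2, fun i => ?_, ⟨by nlinarith, by nlinarith⟩, ?_⟩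
  · have := hsupQ i
    have : 0 ≤ Q / ε := by positivity
    linarith
  rintro x₀ ⟨hx₀R, hx₀η⟩
  set ρ := ‖x₀‖ with hρdef
  have hQε : 0 ≤ Q / ε := by positivity
  have hρ : 0 < ρ := by linarith
  have hQρ : Q ≤ ε * ρ := by
    rw [mul_comm, ← div_le_iff₀ hε]; linarith
  have hv₀ : ‖ρ⁻¹ • x₀ - ξ‖ ≤ r := by
    refine norm_sub_le_of_lt_inner hr.le ?_ hξ1 hx₀η
    rw [norm_smul, norm_inv, Real.norm_of_nonneg hρ.le, ← hρdef, inv_mul_cancel₀ hρ.ne']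
  -- The time scale for which `ρ τ^(2/3) ξ` solves the Kepler problem of mass `M`.
  obtain ⟨T, hT, hT2⟩ : ∃ T : ℝ, 0 < T ∧ T ^ 2 = 2 / 9 * ρ ^ 3 / M :=
    ⟨√(2 / 9 * ρ ^ 3 / M), by positivity, Real.sq_sqrt (by positivity)⟩
  obtain ⟨v, w, hv0, hvw⟩ := hsol (fun i => m i / M)
    (fun i σ => ρ⁻¹ • c i (T * (Real.exp σ - 1))) (fun i => div_nonneg (hm i).le hM.le)
    (by rw [← Finset.sum_div, div_self hM.ne'])
    (fun i => by have := hc i; fun_prop)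
    (fun i σ => by
      rw [norm_smul, norm_inv, Real.norm_of_nonneg hρ.le, inv_mul_le_iff₀ hρ, mul_comm]
      simpa [mul_comm] using (hcQ i _).trans hQρ)
    (ρ⁻¹ • x₀ - ξ) hv₀
  have hvB : ∀ σ, 0 ≤ σ → ‖v σ‖ ≤ r := fun σ hσ => (hvw σ hσ).1
  have hwB : ∀ σ, 0 ≤ σ → ‖w σ‖ ≤ 2 * r := fun σ hσ => (hvw σ hσ).2.1
  let τ : ℝ → ℝ := fun t => 1 + t / T
  have hτ1 : ∀ t, 0 ≤ t → 1 ≤ τ t := fun t ht => by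
    have : 0 ≤ t / T := by positivity
    simp only [τ]; linarith
  have hτ' : ∀ t, HasDerivAt τ T⁻¹ t := fun t => by
    simpa [τ] using ((hasDerivAt_id t).div_const T).const_add 1
  have hτtop : Tendsto τ atTop atTop :=
    tendsto_atTop_add_const_left _ _ (tendsto_id.atTop_div_const hT)
  have hasymp : (fun t => ‖ρ • parabolicCurve ξ v (τ t)‖) ~[atTop]
      (fun t : ℝ => (9 / 2 * M) ^ (1 / 3 : ℝ) * t ^ (2 / 3 : ℝ)) := by
    have hconst : ρ * (T⁻¹) ^ (2 / 3 : ℝ) = (9 / 2 * M) ^ (1 / 3 : ℝ) := by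
      have h3 : 9 / 2 * M = (ρ * (T⁻¹) ^ (2 / 3 : ℝ)) ^ (3 : ℝ) := by
        rw [Real.mul_rpow hρ.le (by positivity), ← Real.rpow_mul (by positivity)]
        norm_num
        rw [hT2]
        field_simp
      rw [h3, ← Real.rpow_mul (by positivity)]
      norm_num
    have h := (IsEquivalent.refl (u := fun _ : ℝ => ρ)).mul
      (((isEquivalent_norm_parabolicCurve hξ1 hvB).comp_tendsto hτtop).trans
        (isEquivalent_one_add_div_rpow hT (2 / 3)))
    refine (h.congr_left (.of_forall fun t => ?_)).congr_right (.of_forall fun t => ?_)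
    · simp [norm_smul, abs_of_pos hρ]
    · rw [Pi.mul_apply, ← mul_assoc, hconst]
  refine ⟨fun t => ρ • parabolicCurve ξ v (τ t), ⟨fun t => (ρ / T) •
    parabolicVelocity ξ v w (τ t), fun t ht => ?_, ?_, ?_⟩, ?_, ?_, hasymp⟩
  · have hτ0 : 0 < τ t := one_pos.trans_le (hτ1 t ht)
    obtain ⟨-, -, hv, hw, hne⟩ := hvw (Real.log (τ t)) (Real.log_nonneg (hτ1 t ht))
    have hexp : ∀ a : ℝ, Real.exp (a * Real.log (τ t)) = τ t ^ a := fun a => by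
      rw [Real.rpow_def_of_pos hτ0, mul_comm]
    have htime : T * (Real.exp (Real.log (τ t)) - 1) = t := by
      rw [Real.exp_log hτ0]
      simp only [τ]
      field_simp
      ring
    -- The position relative to the `i`-th centre, divided by `ρ τ^(2/3)`.
    let z : Fin N → EuclideanSpace ℝ (Fin d) := fun i => rescaledPosition ξ
      (fun σ => ρ⁻¹ • c i (T * (Real.exp σ - 1))) (Real.log (τ t)) (v (Real.log (τ t)))
    have hz : ∀ i, ρ • parabolicCurve ξ v (τ t) - c i t = (ρ * τ t ^ (2 / 3 : ℝ)) • z i := by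
      intro i
      have e1 : Real.exp (-Real.log (τ t) / 6) = τ t ^ (-1 / 6 : ℝ) := by
        rw [← hexp]; ring_nf
      have e2 : Real.exp (-(2 * Real.log (τ t)) / 3) = (τ t ^ (2 / 3 : ℝ))⁻¹ := by
        rw [← Real.rpow_neg hτ0.le, ← hexp]; ring_nf
      simp only [z, rescaledPosition]
      have hp : 0 < τ t ^ (2 / 3 : ℝ) := by positivity
      have e3 : ρ * τ t ^ (2 / 3 : ℝ) * ((τ t ^ (2 / 3 : ℝ))⁻¹ * ρ⁻¹) = 1 := by field_simp
      rw [htime, e1, e2, parabolicCurve_eq_smul ξ v hτ0, smul_sub, smul_smul _ ρ⁻¹,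
        smul_smul _ (_ * ρ⁻¹), e3, one_smul, smul_smul]
    have hforce : centreForce m c t (ρ • parabolicCurve ξ v (τ t)) =
        -((ρ * τ t ^ (2 / 3 : ℝ)) ^ 2)⁻¹ • ∑ i, m i • keplerField (z i) := by
      have hpos : 0 < ρ * τ t ^ (2 / 3 : ℝ) := by positivity
      rw [centreForce, neg_smul, Finset.smul_sum]
      congr 1
      refine Finset.sum_congr rfl fun i _ => ?_
      rw [div_eq_mul_inv, mul_smul, ← keplerField, hz i, keplerField_smul hpos, smul_comm]
    refine ⟨fun i h => ?_, ?_, ?_⟩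
    · have hzi := hz i
      rw [sub_eq_zero.2 h] at hzi
      have hpos : 0 < ρ * τ t ^ (2 / 3 : ℝ) := by positivity
      exact hne i ((smul_eq_zero.1 hzi.symm).resolve_left hpos.ne')
    · refine HasDerivAt.hasDerivWithinAt ?_
      refine (((hasDerivAt_parabolicCurve ξ hτ0 hv).scomp t (hτ' t)).const_smul ρ).congr_deriv ?_
      rw [smul_smul, div_eq_mul_inv]
    · refine HasDerivAt.hasDerivWithinAt ?_
      refine (((hasDerivAt_parabolicVelocity ξ hτ0 hv hw).scomp t (hτ' t)).const_smul
        (ρ / T)).congr_deriv ?_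
      have hsum : ∑ i, (m i / M) • keplerField (z i) = M⁻¹ • ∑ i, m i • keplerField (z i) := by
        rw [Finset.smul_sum]
        refine Finset.sum_congr rfl fun i _ => ?_
        rw [smul_smul, div_eq_inv_mul]
      have e1 : Real.exp (Real.log (τ t) / 6) = τ t ^ (1 / 6 : ℝ) := by
        rw [← hexp]; ring_nf
      have e2 : τ t ^ (-3 / 2 : ℝ) * τ t ^ (1 / 6 : ℝ) = τ t ^ (-4 / 3 : ℝ) := by
        rw [← Real.rpow_add hτ0]; norm_num
      have e3 : ((ρ * τ t ^ (2 / 3 : ℝ)) ^ 2)⁻¹ = (ρ ^ 2)⁻¹ * τ t ^ (-4 / 3 : ℝ) := by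
        rw [mul_pow, mul_inv, ← Real.rpow_natCast (τ t ^ _), ← Real.rpow_mul hτ0.le,
          ← Real.rpow_neg hτ0.le]
        norm_num
      have e4 : ρ / T * T⁻¹ = 9 / 2 * M * (ρ ^ 2)⁻¹ := by
        rw [div_eq_mul_inv, mul_assoc, ← mul_inv, ← sq, hT2]
        field_simp
      have hrhs : -((2 / 9 * τ t ^ (-4 / 3 : ℝ)) • ξ) + τ t ^ (-3 / 2 : ℝ) •
          (v (Real.log (τ t)) + rescaledForce ξ (fun i => m i / M)
            (fun i σ => ρ⁻¹ • c i (T * (Real.exp σ - 1))) (Real.log (τ t)) (v (Real.log (τ t)))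
            - (1 / 4 : ℝ) • v (Real.log (τ t))) =
          -((2 / 9 * τ t ^ (-4 / 3 : ℝ) * M⁻¹) • ∑ i, m i • keplerField (z i)) := by
        rw [rescaledForce, hsum, e1, ← e2]
        module
      rw [hforce, hrhs, e3, smul_smul, e4, smul_neg, neg_smul, smul_smul]
      congr 2
      field_simp
  · refine hasymp.symm.tendsto_atTop ?_
    refine Tendsto.const_mul_atTop (by positivity) (tendsto_rpow_atTop (by norm_num))
  · simpa using ((tendsto_parabolicVelocity ξ hvB hwB).comp hτtop).const_smul (ρ / T)
  · have : τ 0 = 1 := by simp [τ]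
    simp [this, parabolicCurve, hv0, smul_smul, hρ.ne']
  · refine ((tendsto_parabolicCurve_direction hξ1 hvB).comp hτtop).congr fun t => ?_
    rw [Function.comp_apply, norm_smul, Real.norm_of_nonneg hρ.le, smul_smul, mul_inv,
      mul_right_comm, inv_mul_cancel₀ hρ.ne', one_mul]
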